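/- All maps are continuous. A metrizable space $Y$ is an \emph{absolute neighbourhood retract} (ANR) if, for every metrizable space $Z$ and every closed embedding $e\colon Y\to Z$, the image $e(Y)$ is a retract of some open neighbourhood of $e(Y)$ in $Z$. A map is \emph{nullhomotopic} if it is homotopic to a constant map, and a subset $A$ of a space $X$ is \emph{contractible in $X$} if the inclusion $A\hookrightarrow X$ is nullhomotopic. (1) Let $X$ be a compact metric ANR and let $A\subset X$ be an arbitrary subset that is contractible in $X$. Then there is an open set $U\subset X$ with $A\subset U$ such that $U$ is contractible in $X$. (2) More generally, let $X$ be a compact metric space, $K$ a compact metric ANR, $f\colon X\to K$ a map, and $A\subset X$ an arbitrary subset such that $f|_A\colon A\to K$ is nullhomotopic. Then there is an open set $U\subset X$ with $A\subset U$ such that $f|_U\colon U\to K$ is nullhomotopic. -/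

import Mathlib

open Topology

universe u

/-- `Y` is an absolute neighbourhood retract for metrizable spaces: `Y` is metrizable and, whenever
it is embedded as a closed subspace of a metrizable space `Z`, its image is a retract of some open
neighbourhood `V` in `Z`. The map `r : V → Y` followed by the embedding `e` is the retraction. -/
def IsANR (Y : Type u) [TopologicalSpace Y] : Prop :=
  TopologicalSpace.MetrizableSpace Y ∧
    ∀ (Z : Type u) [TopologicalSpace Z] [TopologicalSpace.MetrizableSpace Z] (e : Y → Z),
      IsClosedEmbedding e →
        ∃ V : Set Z, IsOpen V ∧ Set.range e ⊆ V ∧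
          ∃ r : C(V, Y), ∀ (z : V) (y : Y), (z : Z) = e y → r z = y

/-- The set `A ⊆ X` is contractible in `X`: the inclusion map `A → X` is homotopic to a constant
map. -/
def ContractibleIn {X : Type*} [TopologicalSpace X] (A : Set X) : Prop :=
  ((ContinuousMap.id X).restrict A).Nullhomotopic

/-!
Embed the compact ANR `K` into the Banach space `E = C(K, ℝ)` and fix a retraction `r : V → K` of
an open set `V ⊇ K`; some uniform `ε`-neighbourhood of `K` lies in `V`. A null-homotopy of `f|_A`
is a continuous family of paths `h a : I → K ⊆ E`, `a ∈ A`. It need not extend continuously beyond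
`A`, but it suffices to extend it approximately. Choose `δ a > 0` such that `h` is `ε`-close to `h a`
on `A ∩ ball a (2 * δ a)`, and `f` to `f a` on `ball a (δ a)`, and let `U = ⋃ a, ball a (δ a)`. If
`x` lies in the balls around `a` and `b`, then `a` and `b` are closer to each other than twice the
larger radius, hence `h a` and `h b` are `ε`-close. A partition of unity on `U` therefore glues the
`h a` to a continuous family of paths `g x`, `x ∈ U`, each `ε`-close to some `h a` and thus inside
`V`, starting `ε`-close to `f x` and ending at the common endpoint of the `h a`
(`exists_continuous_paths_near`). Composing with `r`, one moves `f x` to `r (g x 0)` along a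
segment and from there to the endpoint along `g x`.
-/

open unitInterval

/-- The Kuratowski embedding, sending a point to the distance function from it. The target
`C(K, ℝ)` is a Banach space in the same universe as `K`. -/
theorem exists_isClosedEmbedding_continuousMap (K : Type*) [MetricSpace K] [CompactSpace K] :
    ∃ e : C(K, C(K, ℝ)), IsClosedEmbedding e := by
  let e : C(K, C(K, ℝ)) := ContinuousMap.curry ⟨fun p : K × K => dist p.1 p.2, by fun_prop⟩
  refine ⟨e, e.continuous.isClosedEmbedding fun x y hxy => ?_⟩
  have h : dist x y = dist y y := DFunLike.congr_fun hxy y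
  simpa using h

/-- A compact ANR is a retract of a uniform neighbourhood in a Banach space. -/
theorem IsANR.exists_retraction_thickening {K : Type*} [MetricSpace K] [CompactSpace K]
    (hK : IsANR K) :
    ∃ (e : C(K, C(K, ℝ))) (ε : ℝ), 0 < ε ∧
      ∃ r : C(Metric.thickening ε (Set.range e), K), ∀ z y, z.1 = e y → r z = y := by
  obtain ⟨e, he⟩ := exists_isClosedEmbedding_continuousMap K
  obtain ⟨V, hV, heV, r, hr⟩ := hK.2 _ e he
  obtain ⟨ε, hε, hεV⟩ :=
    (isCompact_range e.continuous).exists_thickening_subset_open hV heV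
  exact ⟨e, ε, hε, r.comp ⟨Set.inclusion hεV, continuous_inclusion hεV⟩, fun z y hz => hr _ y hz⟩

/-- A family of paths `h` in a normed space, indexed by an arbitrary subset `A`, that starts on `f`
and ends at `p` has an approximate extension to a neighbourhood of `A`, which still ends at `p`
exactly. -/
theorem exists_continuous_paths_near {X E : Type*} [MetricSpace X] [NormedAddCommGroup E]
    [NormedSpace ℝ E] (f : C(X, E)) {A : Set X} (h : C(A, C(I, E))) {p : E}
    (h0 : ∀ a : A, h a 0 = f a) (h1 : ∀ a : A, h a 1 = p) {ε : ℝ} (hε : 0 < ε) :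
    ∃ U : Set X, IsOpen U ∧ A ⊆ U ∧ ∃ g : C(U, C(I, E)), ∀ x : U,
      g x 1 = p ∧ dist (g x 0) (f x) < ε ∧ ∃ a : A, dist (g x) (h a) < ε := by
  have hδ : ∀ a : A, ∃ δ > 0, (∀ b : A, dist (b : X) a < 2 * δ → dist (h b) (h a) < ε) ∧
      ∀ x : X, dist x a < δ → dist (f x) (f a) < ε := by
    intro a
    obtain ⟨δ₁, hδ₁, H₁⟩ := Metric.continuous_iff.1 h.continuous a ε hε
    obtain ⟨δ₂, hδ₂, H₂⟩ := Metric.continuous_iff.1 f.continuous (a : X) ε hε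
    refine ⟨min (δ₁ / 2) δ₂, by positivity, fun b hb => H₁ b ?_, fun x hx => H₂ x ?_⟩
    · have := min_le_left (δ₁ / 2) δ₂
      rw [Subtype.dist_eq]
      linarith
    · exact hx.trans_le (min_le_right _ _)
  choose δ hδ hδh hδf using hδ
  have hclose : ∀ (x : X) (a b : A), dist x a < δ a → dist x b < δ b →
      dist (h a) (h b) < ε := by
    intro x a b ha hb
    have hab : dist (a : X) b ≤ dist x a + dist x b := dist_triangle_left _ _ _
    rcases le_total (δ a) (δ b) with hle | hle
    · exact hδh b a (by linarith)
    · rw [dist_comm]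
      exact hδh a b (by rw [dist_comm]; linarith)
  let U : Set X := ⋃ a : A, Metric.ball a (δ a)
  -- Admissible values of `g` at `x`: a convex condition, satisfied near `x` by any single `h a`
  -- whose ball contains `x`.
  let t : U → Set C(I, E) := fun x =>
    {g | g 1 = p} ∩ {g | g 0 ∈ Metric.ball (f x) ε} ∩
      ⋂ (a : A) (_ : dist (x : X) a < δ a), Metric.ball (h a) ε
  have ht : ∀ x, Convex ℝ (t x) := by
    intro x
    refine (Convex.inter ?_ ?_).inter
      (convex_iInter fun a => convex_iInter fun _ => convex_ball _ _)
    · exact (convex_singleton p).linear_preimage (ContinuousMap.evalCLM ℝ (1 : I)).toLinearMap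
    · exact (convex_ball (f x) ε).linear_preimage (ContinuousMap.evalCLM ℝ (0 : I)).toLinearMap
  have hloc : ∀ x : U, ∃ c : C(I, E), ∀ᶠ y in 𝓝 x, c ∈ t y := by
    intro x
    obtain ⟨a, ha⟩ := Set.mem_iUnion.1 x.2
    refine ⟨h a, ?_⟩
    filter_upwards [continuous_subtype_val.continuousAt.preimage_mem_nhds
      (Metric.isOpen_ball.mem_nhds ha)] with y hy
    refine ⟨⟨h1 a, ?_⟩, ?_⟩
    · change dist (h a 0) (f y) < ε
      rw [h0, dist_comm]
      exact hδf a y hy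
    · simp only [Set.mem_iInter]
      exact fun b hb => hclose y a b hy hb
  obtain ⟨g, hg⟩ := exists_continuous_forall_mem_convex_of_local_const ht hloc
  refine ⟨U, isOpen_iUnion fun a => Metric.isOpen_ball,
    fun a ha => Set.mem_iUnion.2 ⟨⟨a, ha⟩, Metric.mem_ball_self (hδ _)⟩, g, fun x => ?_⟩
  obtain ⟨⟨hg1, hg0⟩, hga⟩ := hg x
  obtain ⟨a, ha⟩ := Set.mem_iUnion.1 x.2
  simp only [Set.mem_iInter] at hga
  exact ⟨hg1, hg0, a, hga a ha⟩

/-- The case of a general map to the ANR; `X` need not be compact. -/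
theorem IsANR.exists_isOpen_nullhomotopic {X K : Type*} [MetricSpace X] [MetricSpace K]
    [CompactSpace K] (hK : IsANR K) (f : C(X, K)) {A : Set X}
    (hA : (f.restrict A).Nullhomotopic) :
    ∃ U : Set X, IsOpen U ∧ A ⊆ U ∧ (f.restrict U).Nullhomotopic := by
  obtain ⟨e, ε, hε, r, hr⟩ := hK.exists_retraction_thickening
  obtain ⟨p, ⟨F⟩⟩ := hA
  let h : C(A, C(I, C(K, ℝ))) := ContinuousMap.curry ⟨fun q => e (F (q.2, q.1)), by fun_prop⟩
  have hh : ∀ a i, h a i = e (F (i, a)) := fun _ _ => rfl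
  obtain ⟨U, hU, hAU, g, hg⟩ := exists_continuous_paths_near (e.comp f) h (p := e p)
    (fun a => by simp [hh]) (fun a => by simp [hh]) hε
  have hgV : ∀ (x : U) (i : I), g x i ∈ Metric.thickening ε (Set.range e) := by
    intro x i
    obtain ⟨-, -, a, ha⟩ := hg x
    exact Metric.mem_thickening_iff.2
      ⟨_, ⟨F (i, a), rfl⟩, (ContinuousMap.dist_apply_le_dist i).trans_lt ha⟩
  have hsV : ∀ (x : U) (i : I), AffineMap.lineMap (e (f x)) (g x 0) (i : ℝ) ∈
      Metric.thickening ε (Set.range e) := by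
    intro x i
    refine Metric.mem_thickening_iff.2 ⟨_, ⟨f x, rfl⟩, ?_⟩
    exact (convex_ball (e (f x)) ε).lineMap_mem (Metric.mem_ball_self hε) (hg x).2.1 i.2
  have hgc : Continuous fun q : I × U => g q.2 q.1 := by fun_prop
  -- The intermediate map: the starting points of the paths `g x`, retracted to `K`.
  let m : C(U, K) := ⟨fun x => r ⟨g x 0, hgV x 0⟩,
    r.continuous.comp (Continuous.subtype_mk (by fun_prop) _)⟩
  have H₁ : (f.restrict U).Homotopic m := ⟨
    { toFun := fun q => r ⟨_, hsV q.2 q.1⟩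
      continuous_toFun := r.continuous.comp (Continuous.subtype_mk (by
        simp only [AffineMap.lineMap_apply_module]
        fun_prop) _)
      map_zero_left := fun x => hr _ _ (by simp)
      map_one_left := fun x => by simp [m] }⟩
  have H₂ : m.Homotopic (ContinuousMap.const U p) := ⟨
    { toFun := fun q => r ⟨_, hgV q.2 q.1⟩
      continuous_toFun := r.continuous.comp (Continuous.subtype_mk hgc _)
      map_zero_left := fun x => rfl
      map_one_left := fun x => hr _ _ (hg x).1 }⟩
  exact ⟨U, hU, hAU, p, H₁.trans H₂⟩

theorem mainTheorem2 :
    (∀ (X : Type*) [MetricSpace X] [CompactSpace X], IsANR X →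
      ∀ A : Set X, ContractibleIn A →
        ∃ U : Set X, IsOpen U ∧ A ⊆ U ∧ ContractibleIn U) ∧
    (∀ (X : Type*) [MetricSpace X] [CompactSpace X]
      (K : Type*) [MetricSpace K] [CompactSpace K], IsANR K →
      ∀ (f : C(X, K)) (A : Set X), (f.restrict A).Nullhomotopic →
        ∃ U : Set X, IsOpen U ∧ A ⊆ U ∧ (f.restrict U).Nullhomotopic) :=
  ⟨fun _ _ _ hX _ hA => hX.exists_isOpen_nullhomotopic (ContinuousMap.id _) hA,
    fun _ _ _ _ _ _ hK f _ hA => hK.exists_isOpen_nullhomotopic f hA⟩
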